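/- Let $G$ be a finite game with finite player set $I$, finite pure strategy sets $S^i$ ($i\in I$) and utility functions $U^i:S=\prod_{j\in I}S^j\to\mathbb{R}$, extended multilinearly to mixed strategy profiles. A correlated equilibrium of $G$ is a probability distribution $\mu$ on $S$ such that, for every $i\in I$ and all $s^i,t^i\in S^i$, $$\sum_{s^{-i}\in S^{-i}}\mu(s^i,s^{-i})\,\bigl[U^i(s^i,s^{-i})-U^i(t^i,s^{-i})\bigr]\ge 0,$$ where $S^{-i}=\prod_{j\ne i}S^j$. Suppose that $G$ has a unique correlated equilibrium $\mu$. Then $\mu$ is a quasi-strict Nash equilibrium; that is, there are mixed strategies $\sigma^i\in\Delta(S^i)$, $i\in I$, such that $\mu(s)=\prod_{i\in I}\sigma^i(s^i)$ for all $s\in S$, the profile $\sigma=(\sigma^i)_{i\in I}$ is a Nash equilibrium of $G$ (for every player $i$ and every mixed strategy $\tau^i\in\Delta(S^i)$, $U^i(\tau^i,\sigma^{-i})\le U^i(\sigma)$), and for every player $i$ every pure best response to $\sigma^{-i}$ lies in the support of $\sigma^i$: if $s^i\in S^i$ satisfies $U^i(s^i,\sigma^{-i})\ge U^i(t^i,\sigma^{-i})$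 for all $t^i\in S^i$, then $\sigma^i(s^i)>0$. -/

import Mathlib

namespace FiniteGame

variable {ι : Type*} [Fintype ι] [DecidableEq ι]
variable {S : ι → Type*} [∀ i, Fintype (S i)] [∀ i, DecidableEq (S i)]

/-- The quantity `h^{a,b}(μ) = ∑_{s^{-i}} μ(a, s^{-i}) (U^i(a, s^{-i}) - U^i(b, s^{-i}))`.
The sum over `s^{-i}` is written as the sum over the profiles `s` whose `i`-th entry is `a`. -/
def incentive (U : ι → (∀ i, S i) → ℝ) (i : ι) (a b : S i) (μ : (∀ i, S i) → ℝ) : ℝ :=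
  ∑ s with s i = a, μ s * (U i s - U i (Function.update s i b))

/-- A correlated equilibrium: a probability distribution over pure strategy profiles that
satisfies all the incentive constraints. -/
def IsCorrelatedEquilibrium (U : ι → (∀ i, S i) → ℝ) (μ : (∀ i, S i) → ℝ) : Prop :=
  μ ∈ stdSimplex ℝ (∀ i, S i) ∧ ∀ (i : ι) (a b : S i), 0 ≤ incentive U i a b μ

/-- A profile of mixed strategies, one for each player. -/
def IsMixedProfile (σ : ∀ i, S i → ℝ) : Prop :=
  ∀ i, σ i ∈ stdSimplex ℝ (S i)

/-- The distribution over pure strategy profiles induced by independent play of `σ`. -/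
def productDist (σ : ∀ i, S i → ℝ) : (∀ i, S i) → ℝ :=
  fun s => ∏ i, σ i (s i)

/-- The multilinear extension of the utility function of player `i`, at the mixed profile `σ`. -/
def expectedUtility (U : ι → (∀ i, S i) → ℝ) (i : ι) (σ : ∀ i, S i → ℝ) : ℝ :=
  ∑ s, productDist σ s * U i s

/-- `U^i(τ, σ^{-i})`: player `i` plays the mixed strategy `τ`, the others follow `σ`. -/
def deviationUtility (U : ι → (∀ i, S i) → ℝ) (σ : ∀ i, S i → ℝ) (i : ι) (τ : S i → ℝ) : ℝ :=
  expectedUtility U i (Function.update σ i τ)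

/-- Nash equilibrium in mixed strategies: no player gains by deviating to another mixed strategy. -/
def IsNashEquilibrium (U : ι → (∀ i, S i) → ℝ) (σ : ∀ i, S i → ℝ) : Prop :=
  IsMixedProfile σ ∧
    ∀ (i : ι), ∀ τ ∈ stdSimplex ℝ (S i), deviationUtility U σ i τ ≤ expectedUtility U i σ

/-- The pure best responses of player `i` to `σ^{-i}`; the pure strategy `a` is identified with
the point mass `Pi.single a 1`. -/
def pureBestResponses (U : ι → (∀ i, S i) → ℝ) (σ : ∀ i, S i → ℝ) (i : ι) : Set (S i) :=
  {a | ∀ b : S i, deviationUtility U σ i (Pi.single b 1) ≤ deviationUtility U σ i (Pi.single a 1)}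

/-- The support of a mixed strategy of one player. -/
def mixedSupport {T : Type*} (τ : T → ℝ) : Set T :=
  {a | 0 < τ a}

/-- A quasi-strict Nash equilibrium: a Nash equilibrium such that every pure best response of
a player belongs to the support of the strategy of this player. -/
def IsQuasiStrictNash (U : ι → (∀ i, S i) → ℝ) (σ : ∀ i, S i → ℝ) : Prop :=
  IsNashEquilibrium U σ ∧ ∀ i, pureBestResponses U σ i ⊆ mixedSupport (σ i)

end FiniteGame

/-!
By strong duality for the linear system that defines correlated equilibria, there are multipliers
`α i a b ≥ 0` of the incentive constraints and `β s ≥ 0` of the nonnegativity constraints, strictly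
complementary to the correlated equilibria, whose weighted sum vanishes identically. Read `α i` as
the jump rates of a Markov process on the strategies of player `i`. When the other players use
stationary mixed strategies, the drift of the payoff of player `i` under this process equals the
expected value of `β`, so it is nonnegative: the payoff is subharmonic and attains its maximum on a
whole recurrent class.

Hence every correlated equilibrium of the dual reduction, in which the players choose among the
stationary distributions on their recurrent classes, is a correlated equilibrium of the original
game, and uniqueness passes to the reduction. Unless there is a single profile, uniqueness provides
a multiplier `α i a b ≠ 0` with `a ≠ b`, so that the reduction is strictly smaller; iterating it
yields a product correlated equilibrium without a fixed-point theorem. Finally, at a pure best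
response the drift is also nonpositive, so `β` vanishes at some profile containing it, and strict
complementarity makes the equilibrium charge that profile.
-/

section LinearInequalities

variable {𝕜 V K : Type*} [Field 𝕜] [LinearOrder 𝕜] [IsStrictOrderedRing 𝕜]

theorem inv_sum_smul_mem_stdSimplex [Fintype K] {x : K → 𝕜} (hx : ∀ k, 0 ≤ x k)
    (hpos : 0 < ∑ k, x k) : (∑ k, x k)⁻¹ • x ∈ stdSimplex 𝕜 K :=
  ⟨fun k => mul_nonneg (inv_nonneg.mpr hpos.le) (hx k), by
    simp only [Pi.smul_apply, smul_eq_mul, ← Finset.mul_sum, inv_mul_cancel₀ hpos.ne']⟩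

theorem mul_sub_nonneg_of_forall_le_sum_mul [Fintype K] {x f : K → 𝕜} (hx : x ∈ stdSimplex 𝕜 K)
    (hf : ∀ k, f k ≤ ∑ j, x j * f j) (k l : K) : 0 ≤ x k * (f k - f l) := by
  set m := ∑ j, x j * f j with hm
  have hterm (j : K) (_ : j ∈ Finset.univ) : 0 ≤ x j * (m - f j) :=
    mul_nonneg (hx.1 j) (sub_nonneg.mpr (hf j))
  have hsum : ∑ j, x j * (m - f j) = 0 := by
    simp only [mul_sub, Finset.sum_sub_distrib, ← Finset.sum_mul, hx.2, one_mul, ← hm, sub_self]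
  have hk := (Finset.sum_eq_zero_iff_of_nonneg hterm).mp hsum k (Finset.mem_univ k)
  linarith [mul_nonneg (hx.1 k) (sub_nonneg.mpr (hf l))]

variable [AddCommGroup V] [Module 𝕜 V]

theorem mem_hull_insert_of_add_smul_mem_hull {v w : V} {s : Set V} {c : V → 𝕜}
    (hs : ∀ u ∈ s, 0 ≤ c u) (hw : c w ≤ 0)
    (h : w + c w • v ∈ PointedCone.hull 𝕜 ((fun u => u + c u • v) '' s)) :
    w ∈ PointedCone.hull 𝕜 (insert v s) := by
  have hv : v ∈ PointedCone.hull 𝕜 (insert v s) :=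
    PointedCone.subset_hull (Set.mem_insert v s)
  have hle : PointedCone.hull 𝕜 ((fun u => u + c u • v) '' s) ≤
      PointedCone.hull 𝕜 (insert v s) := by
    refine Submodule.span_le.mpr ?_
    rintro _ ⟨u, hu, rfl⟩
    exact add_mem (PointedCone.subset_hull (Set.mem_insert_of_mem v hu))
      (PointedCone.smul_mem _ (hs u hu) hv)
  have hadd : w = (w + c w • v) + (-c w) • v := by rw [neg_smul, add_neg_cancel_right]
  rw [hadd]
  exact add_mem (hle h) (PointedCone.smul_mem _ (neg_nonneg.mpr hw) hv)

/-- **Farkas' lemma**. -/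
theorem mem_hull_image_of_forall_nonneg (s : Finset K) (L : K → Module.Dual 𝕜 V)
    (f : Module.Dual 𝕜 V) (h : ∀ x, (∀ k ∈ s, 0 ≤ L k x) → 0 ≤ f x) :
    f ∈ PointedCone.hull 𝕜 (L '' s) := by
  classical
  induction s using Finset.induction_on generalizing L f with
  | empty =>
    have hf : f = 0 := by
      ext x
      exact le_antisymm (by simpa using h (-x) (by simp)) (h x (by simp))
    exact hf ▸ zero_mem _
  | insert k₀ s hk₀ ih =>
    by_cases hs : ∀ x, (∀ k ∈ s, 0 ≤ L k x) → 0 ≤ f x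
    · exact Submodule.span_mono (Set.image_mono (by simp)) (ih L f hs)
    push Not at hs
    obtain ⟨y, hy, hfy⟩ := hs
    have hLy : 0 < -L k₀ y := by
      by_contra! hpos
      exact hfy.not_ge (h y (by simpa using ⟨neg_nonpos.mp hpos, hy⟩))
    set x := (-L k₀ y)⁻¹ • y with hx_def
    have hx : L k₀ x = -1 := by
      rw [hx_def, map_smul, smul_eq_mul, inv_mul_eq_iff_eq_mul₀ hLy.ne', neg_mul_neg, mul_one]
    have hLx (k) (hk : k ∈ s) : 0 ≤ L k x := by
      rw [hx_def, map_smul]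
      exact smul_nonneg (inv_nonneg.mpr hLy.le) (hy k hk)
    have hfx : f x ≤ 0 := by
      rw [hx_def, map_smul]
      exact smul_nonpos_of_nonneg_of_nonpos (inv_nonneg.mpr hLy.le) hfy.le
    rw [Finset.coe_insert, Set.image_insert_eq]
    -- Precompose all functionals with `z ↦ z + L k₀ z • x`, the projection onto `ker (L k₀)`.
    refine mem_hull_insert_of_add_smul_mem_hull (c := fun g => g x)
      (Set.forall_mem_image.mpr hLx) hfx ?_
    rw [Set.image_image]
    refine ih _ _ fun z hz => ?_
    have hmem := h (z + L k₀ z • x) fun k hk => ?_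
    · simpa [mul_comm] using hmem
    rcases Finset.mem_insert.mp hk with rfl | hk
    · simp [hx]
    · simpa [mul_comm] using hz k hk

theorem exists_pos_forall_nonneg_add_smul [Finite K] (L : K → Module.Dual 𝕜 V) {x d : V}
    (hx : ∀ k, 0 ≤ L k x) (hd : ∀ k, L k x = 0 → 0 ≤ L k d) :
    ∃ r : 𝕜, 0 < r ∧ ∀ k, 0 ≤ L k (x + r • d) := by
  have hpos (k : K) : ∃ r : 𝕜, 0 < r ∧ ∀ t, 0 < t → t < r → 0 ≤ L k x + t * L k d := by
    rcases (hx k).eq_or_lt with hk | hk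
    · exact ⟨1, one_pos, fun t ht _ => by simpa [← hk] using mul_nonneg ht.le (hd k hk.symm)⟩
    · refine ⟨L k x / (|L k d| + 1), by positivity, fun t ht htr => ?_⟩
      rw [lt_div_iff₀ (by positivity)] at htr
      nlinarith [neg_abs_le (L k d)]
  choose ρ hρ hnonneg using hpos
  obtain ⟨r, hr, hrρ⟩ := Pi.exists_forall_pos_add_lt hρ
  exact ⟨r, hr, fun k => by simpa using hnonneg k r hr (by simpa using hrρ k)⟩

variable [Fintype K]

theorem exists_sum_smul_eq_zero_strictly_complementary (L : K → Module.Dual 𝕜 V) :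
    ∃ c : K → 𝕜, (∀ k, 0 ≤ c k) ∧ ∑ k, c k • L k = 0 ∧
      ∀ k, 0 < c k ∨ ∃ x, (∀ j, 0 ≤ L j x) ∧ 0 < L k x := by
  classical
  have hsingle (k : K) : ∃ c : K → 𝕜, (∀ j, 0 ≤ c j) ∧ ∑ j, c j • L j = 0 ∧
      (0 < c k ∨ ∃ x, (∀ j, 0 ≤ L j x) ∧ 0 < L k x) := by
    by_cases hk : ∃ x, (∀ j, 0 ≤ L j x) ∧ 0 < L k x
    · exact ⟨0, fun _ => le_rfl, by simp, Or.inr hk⟩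
    push Not at hk
    have hmem := mem_hull_image_of_forall_nonneg Finset.univ L (-L k) fun x hx => by
      simpa using hk x fun j => hx j (Finset.mem_univ j)
    rw [Finset.coe_univ, Set.image_univ] at hmem
    obtain ⟨c, hc⟩ := (Submodule.mem_span_range_iff_exists_fun _).mp hmem
    refine ⟨fun j => c j + (Pi.single k 1 : K → 𝕜) j, fun j => ?_, ?_, Or.inl ?_⟩
    · exact add_nonneg (c j).2 (by by_cases h : j = k <;> simp [h])
    · simp [add_smul, Finset.sum_add_distrib, hc, Pi.single_apply]
    · simpa using add_pos_of_nonneg_of_pos (c k).2 one_pos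
  choose c hc hsum hpos using hsingle
  refine ⟨∑ k, c k, fun j => ?_, ?_, fun k => (hpos k).imp_left fun hk => ?_⟩
  · simpa using Finset.sum_nonneg fun k _ => hc k j
  · simp only [Finset.sum_apply, Finset.sum_smul]
    rw [Finset.sum_comm]
    exact Finset.sum_eq_zero fun k _ => hsum k
  · simpa using Finset.sum_pos' (fun j _ => hc j k) ⟨k, Finset.mem_univ k, hk⟩

/-- **Gordan's theorem of the alternative**. -/
theorem exists_mem_stdSimplex_sum_smul_eq_zero (L : K → Module.Dual 𝕜 V)
    (h : ∀ x, ∃ k, L k x ≤ 0) : ∃ c ∈ stdSimplex 𝕜 K, ∑ k, c k • L k = 0 := by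
  obtain ⟨c, hc, hsum, hcomp⟩ := exists_sum_smul_eq_zero_strictly_complementary L
  have hpos : ∃ k, 0 < c k := by
    by_contra! hle
    choose x hx hxpos using fun k => (hcomp k).resolve_left (hle k).not_gt
    obtain ⟨k, hk⟩ := h (∑ j, x j)
    refine hk.not_gt ?_
    rw [map_sum]
    exact Finset.sum_pos' (fun j _ => hx j k) ⟨k, Finset.mem_univ k, hxpos k⟩
  obtain ⟨k, hk⟩ := hpos
  refine ⟨_, inv_sum_smul_mem_stdSimplex hc
    (Finset.sum_pos' (fun j _ => hc j) ⟨k, Finset.mem_univ k, hk⟩), ?_⟩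
  simp only [Pi.smul_apply, smul_assoc, ← Finset.smul_sum, hsum, smul_zero]

end LinearInequalities

section RecurrentClasses

variable {R A : Type*} [Zero R]

/-- No rate leads out of `B`. -/
def IsAbsorbing (w : A → A → R) (B : Finset A) : Prop :=
  ∀ a ∈ B, ∀ b ∉ B, w a b = 0

theorem isAbsorbing_univ [Fintype A] (w : A → A → R) : IsAbsorbing w Finset.univ :=
  fun _ _ b hb => absurd (Finset.mem_univ b) hb

/-- The recurrent classes of the Markov jump process with transition rates `w`: its minimal
nonempty absorbing sets. -/
def RecurrentClass (w : A → A → R) : Type _ :=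
  {B : Finset A // Minimal (fun B => B.Nonempty ∧ IsAbsorbing w B) B}

namespace RecurrentClass

variable {w : A → A → R}

noncomputable instance : DecidableEq (RecurrentClass w) :=
  Classical.decEq _

theorem exists_subset {B : Finset A} (hne : B.Nonempty) (hB : IsAbsorbing w B) :
    ∃ t : RecurrentClass w, t.1 ⊆ B := by
  obtain ⟨C, hCB, hC⟩ := exists_minimal_le_of_wellFoundedLT
    (fun B => B.Nonempty ∧ IsAbsorbing w B) B ⟨hne, hB⟩
  exact ⟨⟨C, hC⟩, hCB⟩

theorem eq_of_mem_of_mem {t t' : RecurrentClass w} {a : A} (h : a ∈ t.1) (h' : a ∈ t'.1) :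
    t = t' := by
  classical
  have hinter : (t.1 ∩ t'.1).Nonempty ∧ IsAbsorbing w (t.1 ∩ t'.1) := by
    refine ⟨⟨a, Finset.mem_inter.mpr ⟨h, h'⟩⟩, fun b hb c hc => ?_⟩
    obtain ⟨hbt, hbt'⟩ := Finset.mem_inter.mp hb
    by_cases hct : c ∈ t.1
    · exact t'.2.prop.2 b hbt' c fun hct' => hc (Finset.mem_inter.mpr ⟨hct, hct'⟩)
    · exact t.2.prop.2 b hbt c hct
  exact Subtype.ext <| (t.2.eq_of_le hinter Finset.inter_subset_left).symm.trans
    (t'.2.eq_of_le hinter Finset.inter_subset_right)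

theorem representative_injective {g : RecurrentClass w → A} (hg : ∀ t, g t ∈ t.1) :
    Function.Injective g :=
  fun t t' h => eq_of_mem_of_mem (hg t) (h ▸ hg t')

instance [Finite A] [Nonempty A] : Nonempty (RecurrentClass w) :=
  have := Fintype.ofFinite A
  (exists_subset Finset.univ_nonempty (isAbsorbing_univ w)).nonempty

variable [Fintype A]

noncomputable instance : Fintype (RecurrentClass w) :=
  @Subtype.fintype _ _ (Classical.decPred _) _

variable (w) in
theorem card_le : Fintype.card (RecurrentClass w) ≤ Fintype.card A := by
  choose g hg using fun t : RecurrentClass w => t.2.prop.1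
  exact Fintype.card_le_of_injective g (representative_injective hg)

theorem card_lt {a b : A} (hab : a ≠ b) (hw : w a b ≠ 0) :
    Fintype.card (RecurrentClass w) < Fintype.card A := by
  choose g hg using fun t : RecurrentClass w => t.2.prop.1
  refine Fintype.card_lt_of_injective_not_surjective g (representative_injective hg) fun hsurj => ?_
  obtain ⟨t, rfl⟩ := hsurj a
  refine hw (t.2.prop.2 _ (hg t) b fun hb => hab ?_)
  obtain ⟨t', rfl⟩ := hsurj b
  rw [eq_of_mem_of_mem hb (hg t')]

end RecurrentClass

end RecurrentClasses

section StationaryVectors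

variable {𝕜 A : Type*} [Field 𝕜] [Fintype A]

/-- The generator of the Markov jump process with transition rates `w`, as a family of functionals:
`drift w a f` is the rate of change of the mean of `f` when the process is at `a`. -/
def drift (w : A → A → 𝕜) (a : A) : Module.Dual 𝕜 (A → 𝕜) :=
  ∑ b, w a b • (LinearMap.proj (R := 𝕜) (φ := fun _ => 𝕜) b - LinearMap.proj a)

theorem drift_apply (w : A → A → 𝕜) (a : A) (f : A → 𝕜) :
    drift w a f = ∑ b, w a b * (f b - f a) := by
  simp [drift]

/-- The invariant vectors of the Markov jump process with transition rates `w`. -/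
def stationary (w : A → A → 𝕜) : Submodule 𝕜 (A → 𝕜) :=
  LinearMap.ker (Fintype.linearCombination 𝕜 (drift w))

theorem mem_stationary {w : A → A → 𝕜} {x : A → 𝕜} :
    x ∈ stationary w ↔ ∑ a, x a • drift w a = 0 :=
  Iff.rfl

theorem sum_mul_drift_eq_zero {w : A → A → 𝕜} {x : A → 𝕜} (hx : x ∈ stationary w) (f : A → 𝕜) :
    ∑ a, x a * drift w a f = 0 := by
  simpa using LinearMap.congr_fun (mem_stationary.mp hx) f

variable [LinearOrder 𝕜] [IsStrictOrderedRing 𝕜] {w : A → A → 𝕜} (hw : ∀ a b, 0 ≤ w a b)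

include hw in
theorem drift_nonpos_of_isAbsorbing {B : Finset A} (hB : IsAbsorbing w B) {f : A → 𝕜} {a : A}
    (ha : a ∈ B) (hmax : ∀ b ∈ B, f b ≤ f a) : drift w a f ≤ 0 := by
  rw [drift_apply]
  refine Finset.sum_nonpos fun b _ => ?_
  by_cases hb : b ∈ B
  · exact mul_nonpos_of_nonneg_of_nonpos (hw a b) (sub_nonpos.mpr (hmax b hb))
  · rw [hB a ha b hb, zero_mul]

include hw in
theorem exists_mem_stationary_of_isAbsorbing {B : Finset A} (hne : B.Nonempty)
    (hB : IsAbsorbing w B) :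
    ∃ x ∈ stdSimplex 𝕜 A, x ∈ stationary w ∧ ∀ a ∉ B, x a = 0 := by
  classical
  obtain ⟨c, hc, hsum⟩ := exists_mem_stdSimplex_sum_smul_eq_zero (fun a : B => drift w a) fun f =>
    have ⟨a, ha, hmax⟩ := Finset.exists_max_image B f hne
    ⟨⟨a, ha⟩, drift_nonpos_of_isAbsorbing hw hB ha hmax⟩
  refine ⟨∑ a : B, c a • Pi.single (a : A) 1, ?_, ?_, fun a ha => ?_⟩
  · exact (convex_stdSimplex 𝕜 A).sum_mem (fun a _ => hc.1 a) hc.2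
      fun a _ => single_mem_stdSimplex 𝕜 (a : A)
  · rw [stationary, LinearMap.mem_ker, map_sum]
    simpa using hsum
  · rw [Finset.sum_apply]
    refine Finset.sum_eq_zero fun b _ => ?_
    simp [ne_of_mem_of_not_mem b.2 ha |>.symm]

include hw in
theorem exists_recurrentClass_forall_le [Nonempty A] {f : A → 𝕜} (hf : ∀ a, 0 ≤ drift w a f) :
    ∃ t : RecurrentClass w, ∀ a ∈ t.1, ∀ b, f b ≤ f a := by
  classical
  obtain ⟨m, hm⟩ := Finite.exists_max f
  have habs : IsAbsorbing w {a | f a = f m} := by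
    simp only [IsAbsorbing, Finset.mem_filter_univ]
    intro a ha b hb
    have hterm (c : A) (_ : c ∈ Finset.univ) : w a c * (f c - f a) ≤ 0 :=
      mul_nonpos_of_nonneg_of_nonpos (hw a c) (by linarith [hm c])
    have hsum : ∑ c, w a c * (f c - f a) = 0 :=
      le_antisymm (Finset.sum_nonpos hterm) (drift_apply w a f ▸ hf a)
    have hzero := (Finset.sum_eq_zero_iff_of_nonpos hterm).mp hsum b (Finset.mem_univ b)
    exact (mul_eq_zero.mp hzero).resolve_right (sub_ne_zero.mpr (ha ▸ hb))
  obtain ⟨t, ht⟩ := RecurrentClass.exists_subset ⟨m, by simp⟩ habs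
  refine ⟨t, fun a ha b => ?_⟩
  rw [(Finset.mem_filter.mp (ht ha)).2]
  exact hm b

namespace RecurrentClass

/-- A chosen stationary probability vector supported in a recurrent class. -/
noncomputable def dist (t : RecurrentClass w) : A → 𝕜 :=
  (exists_mem_stationary_of_isAbsorbing hw t.2.prop.1 t.2.prop.2).choose

variable (t : RecurrentClass w)

theorem dist_mem_stdSimplex : dist hw t ∈ stdSimplex 𝕜 A :=
  (exists_mem_stationary_of_isAbsorbing hw t.2.prop.1 t.2.prop.2).choose_spec.1

theorem dist_mem_stationary : dist hw t ∈ stationary w :=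
  (exists_mem_stationary_of_isAbsorbing hw t.2.prop.1 t.2.prop.2).choose_spec.2.1

theorem dist_eq_zero_of_notMem {a : A} (ha : a ∉ t.1) : dist hw t a = 0 :=
  (exists_mem_stationary_of_isAbsorbing hw t.2.prop.1 t.2.prop.2).choose_spec.2.2 a ha

theorem eq_of_dist_ne_zero {t t' : RecurrentClass w} {a : A} (h : dist hw t a ≠ 0)
    (h' : dist hw t' a ≠ 0) : t = t' :=
  eq_of_mem_of_mem (not_imp_comm.mp (dist_eq_zero_of_notMem hw t) h)
    (not_imp_comm.mp (dist_eq_zero_of_notMem hw t') h')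

end RecurrentClass

theorem exists_recurrentClass_forall_le_sum_dist [Nonempty A] {f : A → 𝕜}
    (hf : ∀ a, 0 ≤ drift w a f) :
    ∃ t : RecurrentClass w, ∀ b, f b ≤ ∑ a, t.dist hw a * f a := by
  obtain ⟨t, ht⟩ := exists_recurrentClass_forall_le hw hf
  refine ⟨t, fun b => ?_⟩
  calc f b = ∑ a, t.dist hw a * f b := by
        rw [← Finset.sum_mul, (t.dist_mem_stdSimplex hw).2, one_mul]
    _ ≤ ∑ a, t.dist hw a * f a := Finset.sum_le_sum fun a _ => ?_
  by_cases ha : a ∈ t.1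
  · exact mul_le_mul_of_nonneg_left (ht a ha b) ((t.dist_mem_stdSimplex hw).1 a)
  · simp [t.dist_eq_zero_of_notMem hw ha]

end StationaryVectors

namespace FiniteGame

variable {ι : Type*} {S : ι → Type*}

theorem isMixedProfile_update [DecidableEq ι] [∀ i, Fintype (S i)] {σ : ∀ i, S i → ℝ}
    (hσ : IsMixedProfile σ) {i : ι} {τ : S i → ℝ} (hτ : τ ∈ stdSimplex ℝ (S i)) :
    IsMixedProfile (Function.update σ i τ) :=
  (Function.forall_update_iff σ fun j ρ => ρ ∈ stdSimplex ℝ (S j)).mpr ⟨hτ, fun j _ => hσ j⟩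

variable [Fintype ι]

theorem productDist_mem_stdSimplex [DecidableEq ι] [∀ i, Fintype (S i)] {σ : ∀ i, S i → ℝ}
    (hσ : IsMixedProfile σ) : productDist σ ∈ stdSimplex ℝ (∀ i, S i) := by
  refine ⟨fun s => Finset.prod_nonneg fun i _ => (hσ i).1 (s i), ?_⟩
  simp only [productDist, ← Fintype.prod_sum, (hσ _).2, Finset.prod_const_one]

variable [DecidableEq ι]

theorem productDist_eq_mul_prod_erase (σ : ∀ i, S i → ℝ) (i : ι) (s : ∀ i, S i) :
    productDist σ s = σ i (s i) * ∏ j ∈ Finset.univ.erase i, σ j (s j) :=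
  (Finset.mul_prod_erase _ _ (Finset.mem_univ i)).symm

theorem productDist_update (σ : ∀ i, S i → ℝ) (i : ι) (τ : S i → ℝ) (s : ∀ i, S i) :
    productDist (Function.update σ i τ) s =
      τ (s i) * ∏ j ∈ Finset.univ.erase i, σ j (s j) := by
  rw [productDist_eq_mul_prod_erase _ i, Function.update_self]
  congr 1
  exact Finset.prod_congr rfl fun j hj => by
    rw [Function.update_of_ne (Finset.ne_of_mem_erase hj)]

section LiftDist

variable {T : ι → Type*} [∀ i, Fintype (T i)]

/-- The distribution over pure profiles induced by a distribution over the profiles of a game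
restricted to the mixed strategies `x`. -/
def liftDist (x : ∀ i, T i → S i → ℝ) (ν : (∀ i, T i) → ℝ) : (∀ i, S i) → ℝ :=
  ∑ t, ν t • productDist fun i => x i (t i)

variable {x : ∀ i, T i → S i → ℝ}

theorem liftDist_mem_stdSimplex [∀ i, Fintype (S i)] (hx : ∀ i u, x i u ∈ stdSimplex ℝ (S i))
    {ν : (∀ i, T i) → ℝ} (hν : ν ∈ stdSimplex ℝ (∀ i, T i)) :
    liftDist x ν ∈ stdSimplex ℝ (∀ i, S i) :=
  (convex_stdSimplex ℝ _).sum_mem (fun t _ => hν.1 t) hν.2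
    fun t _ => productDist_mem_stdSimplex fun i => hx i (t i)

theorem liftDist_injective (hx : ∀ i u, x i u ≠ 0)
    (hdisj : ∀ i u u' a, x i u a ≠ 0 → x i u' a ≠ 0 → u = u') :
    Function.Injective (liftDist x) := by
  refine fun ν ν' h => funext fun t => ?_
  choose s hs using fun i => Function.ne_iff.mp (hx i (t i))
  have hval (ν : (∀ i, T i) → ℝ) :
      liftDist x ν s = ν t * productDist (fun i => x i (t i)) s := by
    simp only [liftDist, Finset.sum_apply, Pi.smul_apply, smul_eq_mul]
    refine Finset.sum_eq_single_of_mem t (Finset.mem_univ t) fun t' _ ht' => ?_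
    obtain ⟨i, hi⟩ := Function.ne_iff.mp ht'
    have hzero : x i (t' i) (s i) = 0 := by
      by_contra hne
      exact hi (hdisj i _ _ _ hne (hs i))
    rw [productDist, Finset.prod_eq_zero (Finset.mem_univ i) hzero, mul_zero]
  have hne : productDist (fun i => x i (t i)) s ≠ 0 := Finset.prod_ne_zero_iff.mpr fun i _ => hs i
  refine mul_right_cancel₀ hne ?_
  rw [← hval, ← hval, h]

theorem liftDist_productDist (x : ∀ i, T i → S i → ℝ)
    (τ : ∀ i, T i → ℝ) :
    liftDist x (productDist τ) = productDist fun i => ∑ u, τ i u • x i u := by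
  funext s
  simp only [liftDist, Finset.sum_apply, Pi.smul_apply, smul_eq_mul, productDist,
    Fintype.prod_sum, Finset.prod_mul_distrib]

end LiftDist

variable [∀ i, Fintype (S i)] [∀ i, DecidableEq (S i)] (U : ι → (∀ i, S i) → ℝ)

theorem sum_filter_update {M : Type*} [AddCommMonoid M] {i : ι} (a b : S i) (F : (∀ i, S i) → M) :
    ∑ s with s i = a, F (Function.update s i b) = ∑ s with s i = b, F s := by
  refine Finset.sum_nbij' (Function.update · i b) (Function.update · i a) ?_ ?_ ?_ ?_ ?_ <;>
    simp +contextual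

section Payoffs

/-- The expected payoffs of the pure strategies of player `i` when the others follow `σ`. -/
def purePayoff (σ : ∀ i, S i → ℝ) (i : ι) : S i → ℝ :=
  fun a => deviationUtility U σ i (Pi.single a 1)

theorem purePayoff_update_self (σ : ∀ i, S i → ℝ) (i : ι) (τ : S i → ℝ) :
    purePayoff U (Function.update σ i τ) i = purePayoff U σ i := by
  funext a
  rw [purePayoff, deviationUtility, Function.update_idem, purePayoff, deviationUtility]

theorem purePayoff_eq_sum (σ : ∀ i, S i → ℝ) (i : ι) (a : S i) :
    purePayoff U σ i a =
      ∑ s with s i = a, (∏ j ∈ Finset.univ.erase i, σ j (s j)) * U i s := by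
  simp only [purePayoff, deviationUtility, expectedUtility, productDist_update, Pi.single_apply,
    ite_mul, one_mul, zero_mul, Finset.sum_filter]

theorem purePayoff_eq_sum_update (σ : ∀ i, S i → ℝ) (i : ι) (a b : S i) :
    purePayoff U σ i b = ∑ s with s i = a,
      (∏ j ∈ Finset.univ.erase i, σ j (s j)) * U i (Function.update s i b) := by
  rw [purePayoff_eq_sum, ← sum_filter_update a b]
  refine Finset.sum_congr rfl fun s _ => ?_
  congr 1
  exact Finset.prod_congr rfl fun j hj => by
    rw [Function.update_of_ne (Finset.ne_of_mem_erase hj)]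

theorem deviationUtility_eq_sum (σ : ∀ i, S i → ℝ) (i : ι) (τ : S i → ℝ) :
    deviationUtility U σ i τ = ∑ a, τ a * purePayoff U σ i a := by
  simp only [deviationUtility, expectedUtility, productDist_update, purePayoff_eq_sum,
    Finset.mul_sum]
  rw [← Finset.sum_fiberwise Finset.univ (fun s => s i)]
  refine Finset.sum_congr rfl fun a _ => Finset.sum_congr rfl fun s hs => ?_
  rw [(Finset.mem_filter.mp hs).2, mul_assoc]

theorem expectedUtility_eq_sum (σ : ∀ i, S i → ℝ) (i : ι) :
    expectedUtility U i σ = ∑ a, σ i a * purePayoff U σ i a := by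
  rw [← deviationUtility_eq_sum, deviationUtility, Function.update_eq_self]

theorem incentive_productDist (σ : ∀ i, S i → ℝ) (i : ι) (a b : S i) :
    incentive U i a b (productDist σ) =
      σ i a * (purePayoff U σ i a - purePayoff U σ i b) := by
  rw [purePayoff_eq_sum, purePayoff_eq_sum_update U σ i a b, ← Finset.sum_sub_distrib,
    Finset.mul_sum]
  refine Finset.sum_congr rfl fun s hs => ?_
  rw [productDist_eq_mul_prod_erase σ i, (Finset.mem_filter.mp hs).2]
  ring

end Payoffs

section Constraints

theorem incentive_self (i : ι) (a : S i) (μ : (∀ i, S i) → ℝ) : incentive U i a a μ = 0 := by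
  refine Finset.sum_eq_zero fun s hs => ?_
  rw [← (Finset.mem_filter.mp hs).2, Function.update_eq_self, sub_self, mul_zero]

/-- `incentive` as a linear functional of the distribution. -/
def incentiveLinear (i : ι) (a b : S i) : Module.Dual ℝ ((∀ i, S i) → ℝ) where
  toFun := incentive U i a b
  map_add' μ ν := by simp only [incentive, Pi.add_apply, add_mul, Finset.sum_add_distrib]
  map_smul' r μ := by simp [incentive, mul_assoc, Finset.mul_sum]

/-- The homogeneous linear functionals whose nonnegativity defines correlated equilibria: the
probabilities of the profiles and the incentives. -/
def constraint : (∀ i, S i) ⊕ (Σ i, S i × S i) → Module.Dual ℝ ((∀ i, S i) → ℝ) :=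
  Sum.elim (fun s => LinearMap.proj s) (fun k => incentiveLinear U k.1 k.2.1 k.2.2)

variable {U}

theorem isCorrelatedEquilibrium_iff {μ : (∀ i, S i) → ℝ} :
    IsCorrelatedEquilibrium U μ ↔ ∑ s, μ s = 1 ∧ ∀ k, 0 ≤ constraint U k μ := by
  refine ⟨fun h => ⟨h.1.2, ?_⟩, fun h => ⟨⟨fun s => h.2 (Sum.inl s), h.1⟩, fun i a b =>
    h.2 (Sum.inr ⟨i, a, b⟩)⟩⟩
  rintro (s | ⟨i, a, b⟩)
  exacts [h.1.1 s, h.2 i a b]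

theorem exists_isCorrelatedEquilibrium_constraint_pos {x : (∀ i, S i) → ℝ}
    (hx : ∀ k, 0 ≤ constraint U k x) {k : (∀ i, S i) ⊕ (Σ i, S i × S i)}
    (hk : 0 < constraint U k x) :
    ∃ μ, IsCorrelatedEquilibrium U μ ∧ 0 < constraint U k μ := by
  have hx_nonneg : 0 ≤ x := fun s => hx (Sum.inl s)
  have hx_ne : x ≠ 0 := by
    rintro rfl
    exact hk.ne' (map_zero _)
  have hsum : 0 < ∑ s, x s := Fintype.sum_pos (hx_nonneg.lt_of_ne' hx_ne)
  refine ⟨(∑ s, x s)⁻¹ • x, isCorrelatedEquilibrium_iff.mpr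
    ⟨(inv_sum_smul_mem_stdSimplex hx_nonneg hsum).2, fun j => ?_⟩, ?_⟩
  · rw [map_smul]
    exact smul_nonneg (inv_nonneg.mpr hsum.le) (hx j)
  · rw [map_smul]
    exact smul_pos (inv_pos.mpr hsum) hk

theorem subsingleton_profile_of_strict {μ : (∀ i, S i) → ℝ} (hμ : IsCorrelatedEquilibrium U μ)
    (huniq : {ν | IsCorrelatedEquilibrium U ν}.Subsingleton) (hpos : ∀ s, 0 < μ s)
    (hinc : ∀ i a b, a ≠ b → 0 < incentive U i a b μ) : Subsingleton (∀ i, S i) := by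
  refine ⟨fun s t => ?_⟩
  let d : (∀ i, S i) → ℝ := Pi.single s 1 - Pi.single t 1
  have hd : ∀ k, constraint U k μ = 0 → 0 ≤ constraint U k d := by
    rintro (u | ⟨i, a, b⟩) hk
    · exact absurd hk (hpos u).ne'
    · rcases eq_or_ne a b with rfl | hab
      · exact (incentive_self U i a d).ge
      · exact absurd hk (hinc i a b hab).ne'
  obtain ⟨hsum, hnonneg⟩ := isCorrelatedEquilibrium_iff.mp hμ
  obtain ⟨r, hr, hfeas⟩ := exists_pos_forall_nonneg_add_smul (constraint U) hnonneg hd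
  have hce : IsCorrelatedEquilibrium U (μ + r • d) := by
    refine isCorrelatedEquilibrium_iff.mpr ⟨?_, hfeas⟩
    simp [Finset.sum_add_distrib, hsum, d, ← Finset.mul_sum]
  have hd_zero : d = 0 := by simpa [hr.ne'] using huniq hce hμ
  by_contra hst
  simpa [d, hst] using congrFun hd_zero s

theorem isNashEquilibrium_of_isCorrelatedEquilibrium_productDist {σ : ∀ i, S i → ℝ}
    (hσ : IsMixedProfile σ) (h : IsCorrelatedEquilibrium U (productDist σ)) :
    IsNashEquilibrium U σ := by
  refine ⟨hσ, fun i τ hτ => ?_⟩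
  have hincentive (a b : S i) : 0 ≤ σ i a * (purePayoff U σ i a - purePayoff U σ i b) :=
    incentive_productDist U σ i a b ▸ h.2 i a b
  have hpure (b : S i) : purePayoff U σ i b ≤ expectedUtility U i σ :=
    calc purePayoff U σ i b = ∑ a, σ i a * purePayoff U σ i b := by
          rw [← Finset.sum_mul, (hσ i).2, one_mul]
      _ ≤ ∑ a, σ i a * purePayoff U σ i a :=
          Finset.sum_le_sum fun a _ => by linarith [hincentive a b]
      _ = expectedUtility U i σ := (expectedUtility_eq_sum U σ i).symm
  calc deviationUtility U σ i τ = ∑ b, τ b * purePayoff U σ i b := deviationUtility_eq_sum U σ i τ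
    _ ≤ ∑ b, τ b * expectedUtility U i σ :=
        Finset.sum_le_sum fun b _ => mul_le_mul_of_nonneg_left (hpure b) (hτ.1 b)
    _ = expectedUtility U i σ := by rw [← Finset.sum_mul, hτ.2, one_mul]

theorem isCorrelatedEquilibrium_productDist_of_subsingleton [Subsingleton (∀ i, S i)]
    {σ : ∀ i, S i → ℝ} (hσ : IsMixedProfile σ) : IsCorrelatedEquilibrium U (productDist σ) := by
  refine ⟨productDist_mem_stdSimplex hσ, fun i a b => (Finset.sum_eq_zero fun s _ => ?_).ge⟩
  rw [Subsingleton.elim (Function.update s i b) s, sub_self, mul_zero]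

end Constraints

/-- Dual vectors of the linear system that defines correlated equilibria: multipliers `α` of the
incentive constraints and multipliers `β` of the nonnegativity constraints, for which the weighted
sum of the constraints vanishes identically. -/
structure IsDualVector (α : ∀ i, S i → S i → ℝ) (β : (∀ i, S i) → ℝ) : Prop where
  nonneg : ∀ i a b, 0 ≤ α i a b
  slack_nonneg : ∀ s, 0 ≤ β s
  sum_eq_zero : ∀ μ : (∀ i, S i) → ℝ,
    ∑ s, μ s * β s + ∑ i, ∑ a, ∑ b, α i a b * incentive U i a b μ = 0

theorem exists_isDualVector_strictly_complementary :
    ∃ α β, IsDualVector U α β ∧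
      (∀ s, 0 < β s ∨ ∃ μ, IsCorrelatedEquilibrium U μ ∧ 0 < μ s) ∧
      ∀ i a b, 0 < α i a b ∨ ∃ μ, IsCorrelatedEquilibrium U μ ∧ 0 < incentive U i a b μ := by
  obtain ⟨c, hc, hsum, hcomp⟩ := exists_sum_smul_eq_zero_strictly_complementary (constraint U)
  have hcomp' (k) : 0 < c k ∨ ∃ μ, IsCorrelatedEquilibrium U μ ∧ 0 < constraint U k μ :=
    (hcomp k).imp_right fun ⟨_, hx, hk⟩ => exists_isCorrelatedEquilibrium_constraint_pos hx hk
  refine ⟨fun i a b => c (Sum.inr ⟨i, a, b⟩), fun s => c (Sum.inl s),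
    ⟨fun _ _ _ => hc _, fun _ => hc _, fun μ => ?_⟩, fun s => hcomp' (Sum.inl s),
    fun i a b => hcomp' (Sum.inr ⟨i, a, b⟩)⟩
  have hμ : ∑ k, c k * constraint U k μ = 0 := by
    simpa only [LinearMap.sum_apply, LinearMap.smul_apply, smul_eq_mul, LinearMap.zero_apply]
      using LinearMap.congr_fun hsum μ
  simp only [Fintype.sum_sum_type, Fintype.sum_sigma, Fintype.sum_prod_type] at hμ
  simp only [mul_comm (μ _)]
  exact hμ

namespace IsDualVector

variable {U} {α : ∀ i, S i → S i → ℝ} {β : (∀ i, S i) → ℝ}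

theorem slack_eq_zero (h : IsDualVector U α β) (hα : ∀ i a b, a ≠ b → α i a b = 0)
    (s : ∀ i, S i) : β s = 0 := by
  have hinc : ∑ i, ∑ a, ∑ b, α i a b * incentive U i a b (Pi.single s 1) = 0 := by
    refine Finset.sum_eq_zero fun i _ => Finset.sum_eq_zero fun a _ =>
      Finset.sum_eq_zero fun b _ => ?_
    rcases eq_or_ne a b with rfl | hab
    · rw [incentive_self, mul_zero]
    · rw [hα i a b hab, zero_mul]
  simpa [hinc, Pi.single_apply] using h.sum_eq_zero (Pi.single s 1)

theorem sum_productDist_mul (h : IsDualVector U α β) (σ : ∀ i, S i → ℝ) :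
    ∑ s, productDist σ s * β s = ∑ i, ∑ a, σ i a * drift (α i) a (purePayoff U σ i) := by
  rw [eq_neg_of_add_eq_zero_left (h.sum_eq_zero (productDist σ))]
  simp only [← Finset.sum_neg_distrib, incentive_productDist, drift_apply, Finset.mul_sum]
  refine Finset.sum_congr rfl fun i _ => Finset.sum_congr rfl fun a _ =>
    Finset.sum_congr rfl fun b _ => ?_
  ring

theorem sum_productDist_update_single_mul (h : IsDualVector U α β) {σ : ∀ i, S i → ℝ} {i : ι}
    (hσ : ∀ j, j ≠ i → σ j ∈ stationary (α j)) (a : S i) :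
    ∑ s, productDist (Function.update σ i (Pi.single a 1)) s * β s =
      drift (α i) a (purePayoff U σ i) := by
  rw [h.sum_productDist_mul, Finset.sum_eq_single_of_mem i (Finset.mem_univ i),
    purePayoff_update_self]
  · simp [Pi.single_apply]
  · intro j _ hj
    rw [Function.update_of_ne hj]
    exact sum_mul_drift_eq_zero (hσ j hj) _

theorem drift_purePayoff_nonneg (h : IsDualVector U α β) {σ : ∀ i, S i → ℝ}
    (hmix : IsMixedProfile σ) {i : ι} (hσ : ∀ j, j ≠ i → σ j ∈ stationary (α j)) (a : S i) :
    0 ≤ drift (α i) a (purePayoff U σ i) := by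
  rw [← h.sum_productDist_update_single_mul hσ a]
  exact Finset.sum_nonneg fun s _ => mul_nonneg
    ((productDist_mem_stdSimplex (isMixedProfile_update hmix (single_mem_stdSimplex ℝ a))).1 s)
    (h.slack_nonneg s)

theorem exists_slack_eq_zero (h : IsDualVector U α β) {σ : ∀ i, S i → ℝ}
    (hmix : IsMixedProfile σ) {i : ι} (hσ : ∀ j, j ≠ i → σ j ∈ stationary (α j)) {a : S i}
    (ha : a ∈ pureBestResponses U σ i) : ∃ s : ∀ i, S i, s i = a ∧ β s = 0 := by
  set σ' := Function.update σ i (Pi.single a 1) with hσ'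
  have hdist : productDist σ' ∈ stdSimplex ℝ (∀ i, S i) :=
    productDist_mem_stdSimplex (isMixedProfile_update hmix (single_mem_stdSimplex ℝ a))
  have hle : ∑ s, productDist σ' s * β s ≤ 0 := by
    rw [h.sum_productDist_update_single_mul hσ a]
    exact drift_nonpos_of_isAbsorbing (h.nonneg i) (isAbsorbing_univ (α i)) (Finset.mem_univ a)
      fun b _ => ha b
  have hterm (s) (_ : s ∈ Finset.univ) : 0 ≤ productDist σ' s * β s :=
    mul_nonneg (hdist.1 s) (h.slack_nonneg s)
  have hzero := (Finset.sum_eq_zero_iff_of_nonneg hterm).mp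
    (hle.antisymm (Finset.sum_nonneg hterm))
  obtain ⟨s, hs, hs_ne⟩ := Finset.exists_ne_zero_of_sum_ne_zero (hdist.2.trans_ne one_ne_zero)
  refine ⟨s, ?_, (mul_eq_zero.mp (hzero s hs)).resolve_left hs_ne⟩
  by_contra hsa
  rw [hσ', productDist_update, Pi.single_eq_of_ne hsa, zero_mul] at hs_ne
  exact hs_ne rfl

end IsDualVector

theorem exists_isDualVector_ne_zero [Nontrivial (∀ i, S i)]
    (huniq : {μ | IsCorrelatedEquilibrium U μ}.Subsingleton) :
    ∃ α β, IsDualVector U α β ∧ ∃ i a b, a ≠ b ∧ α i a b ≠ 0 := by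
  obtain ⟨α, β, h, hβ, hα⟩ := exists_isDualVector_strictly_complementary U
  refine ⟨α, β, h, ?_⟩
  by_contra! hzero
  have hpos (s : ∀ i, S i) : ∃ μ, IsCorrelatedEquilibrium U μ ∧ 0 < μ s :=
    (hβ s).resolve_left (h.slack_eq_zero hzero s).not_gt
  have hinc (i : ι) (a b : S i) (hab : a ≠ b) :
      ∃ μ, IsCorrelatedEquilibrium U μ ∧ 0 < incentive U i a b μ :=
    (hα i a b).resolve_left (hzero i a b hab).not_gt
  obtain ⟨μ, hμ, -⟩ := hpos (Classical.arbitrary _)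
  refine not_subsingleton (∀ i, S i) (subsingleton_profile_of_strict hμ huniq
    (fun s => ?_) fun i a b hab => ?_)
  · obtain ⟨ν, hν, hνs⟩ := hpos s
    exact huniq hν hμ ▸ hνs
  · obtain ⟨ν, hν, hνi⟩ := hinc i a b hab
    exact huniq hν hμ ▸ hνi

section RestrictedGame

variable {T : ι → Type*} (x : ∀ i, T i → S i → ℝ)

/-- The utility functions of the game in which every player `i` is restricted to choosing among the
mixed strategies `x i u`, `u : T i`. -/
def restrictedUtility : ι → (∀ i, T i) → ℝ :=
  fun i t => expectedUtility U i fun j => x j (t j)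

theorem restrictedUtility_update (i : ι) (t : ∀ i, T i) (u : T i) :
    restrictedUtility U x i (Function.update t i u) =
      ∑ a, x i u a * purePayoff U (fun j => x j (t j)) i a := by
  rw [← deviationUtility_eq_sum, deviationUtility, restrictedUtility]
  congr 1
  exact funext fun j => Function.apply_update (fun j => x j) t i u j

variable [∀ i, Fintype (T i)]

/-- The payoffs of the pure strategies of player `i` on the event that `i` is told to play `u`. They
are not divided by the probability of this event. -/
def conditionalPayoff [∀ i, DecidableEq (T i)] (ν : (∀ i, T i) → ℝ) (i : ι) (u : T i) : S i → ℝ :=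
  ∑ t with t i = u, ν t • purePayoff U (fun j => x j (t j)) i

variable [∀ i, DecidableEq (T i)] (ν : (∀ i, T i) → ℝ) (i : ι)

theorem incentive_liftDist (a b : S i) :
    incentive U i a b (liftDist x ν) =
      ∑ u, x i u a * (conditionalPayoff U x ν i u a - conditionalPayoff U x ν i u b) := by
  have hlinear : incentive U i a b (liftDist x ν) =
      ∑ t, ν t * incentive U i a b (productDist fun i => x i (t i)) := by
    change incentiveLinear U i a b (liftDist x ν) = _
    rw [liftDist, map_sum]
    exact Finset.sum_congr rfl fun t _ => map_smul _ _ _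
  rw [hlinear, ← Finset.sum_fiberwise Finset.univ (fun t => t i)]
  refine Finset.sum_congr rfl fun u _ => ?_
  simp only [conditionalPayoff, Finset.sum_apply, Pi.smul_apply, smul_eq_mul,
    ← Finset.sum_sub_distrib, Finset.mul_sum]
  refine Finset.sum_congr rfl fun t ht => ?_
  rw [incentive_productDist, (Finset.mem_filter.mp ht).2]
  ring

theorem sum_mul_conditionalPayoff (u u' : T i) :
    ∑ a, x i u' a * conditionalPayoff U x ν i u a =
      ∑ t with t i = u, ν t * restrictedUtility U x i (Function.update t i u') := by
  simp only [restrictedUtility_update, conditionalPayoff, Finset.sum_apply, Pi.smul_apply,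
    smul_eq_mul, Finset.mul_sum]
  rw [Finset.sum_comm]
  exact Finset.sum_congr rfl fun t _ => Finset.sum_congr rfl fun a _ => mul_left_comm _ _ _

theorem incentive_restrictedUtility (u u' : T i) :
    incentive (restrictedUtility U x) i u u' ν =
      ∑ a, x i u a * conditionalPayoff U x ν i u a -
        ∑ a, x i u' a * conditionalPayoff U x ν i u a := by
  rw [sum_mul_conditionalPayoff, sum_mul_conditionalPayoff, ← Finset.sum_sub_distrib]
  refine Finset.sum_congr rfl fun t ht => ?_
  rw [← (Finset.mem_filter.mp ht).2, Function.update_eq_self, mul_sub]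

end RestrictedGame

namespace IsDualVector

variable {U} {α : ∀ i, S i → S i → ℝ} {β : (∀ i, S i) → ℝ} (h : IsDualVector U α β)

/-- The utility functions of the dual reduction: the players are restricted to the stationary
distributions on the recurrent classes of their multipliers. -/
noncomputable def reducedUtility : ι → (∀ i, RecurrentClass (α i)) → ℝ :=
  restrictedUtility U fun i => RecurrentClass.dist (h.nonneg i)

include h in
theorem drift_conditionalPayoff_nonneg {T : ι → Type*} [∀ i, Fintype (T i)]
    [∀ i, DecidableEq (T i)] {x : ∀ i, T i → S i → ℝ} (hx : ∀ i u, x i u ∈ stdSimplex ℝ (S i))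
    (hstat : ∀ i u, x i u ∈ stationary (α i)) {ν : (∀ i, T i) → ℝ} (hν : ∀ t, 0 ≤ ν t) (i : ι)
    (u : T i) (a : S i) : 0 ≤ drift (α i) a (conditionalPayoff U x ν i u) := by
  rw [conditionalPayoff, map_sum]
  refine Finset.sum_nonneg fun t _ => ?_
  rw [map_smul]
  exact smul_nonneg (hν t) <|
    h.drift_purePayoff_nonneg (fun j => hx j (t j)) (fun j _ => hstat j (t j)) a

theorem isCorrelatedEquilibrium_liftDist {ν : (∀ i, RecurrentClass (α i)) → ℝ}
    (hν : IsCorrelatedEquilibrium h.reducedUtility ν) :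
    IsCorrelatedEquilibrium U (liftDist (fun i => RecurrentClass.dist (h.nonneg i)) ν) := by
  have hdist i := RecurrentClass.dist_mem_stdSimplex (h.nonneg i)
  have hstat i := RecurrentClass.dist_mem_stationary (h.nonneg i)
  refine ⟨liftDist_mem_stdSimplex hdist hν.1, fun i a b => ?_⟩
  rw [incentive_liftDist]
  refine Finset.sum_nonneg fun u _ => mul_sub_nonneg_of_forall_le_sum_mul (hdist i u) ?_ a b
  have : Nonempty (S i) := ⟨a⟩
  obtain ⟨u', hu'⟩ := exists_recurrentClass_forall_le_sum_dist (h.nonneg i)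
    (h.drift_conditionalPayoff_nonneg hdist hstat hν.1.1 i u)
  have hincentive := hν.2 i u u'
  rw [reducedUtility, incentive_restrictedUtility] at hincentive
  exact fun c => (hu' c).trans (sub_nonneg.mp hincentive)

theorem subsingleton_isCorrelatedEquilibrium_reducedUtility
    (huniq : {μ | IsCorrelatedEquilibrium U μ}.Subsingleton) :
    {ν | IsCorrelatedEquilibrium h.reducedUtility ν}.Subsingleton := by
  refine (huniq.preimage (liftDist_injective (fun i u hzero => ?_)
    fun i _ _ _ => RecurrentClass.eq_of_dist_ne_zero (h.nonneg i))).anti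
    fun ν hν => h.isCorrelatedEquilibrium_liftDist hν
  simpa [hzero] using (u.dist_mem_stdSimplex (h.nonneg i)).2

theorem exists_stationary_of_isCorrelatedEquilibrium_reducedUtility
    {τ : ∀ i, RecurrentClass (α i) → ℝ} (hτ : IsMixedProfile τ)
    (hce : IsCorrelatedEquilibrium h.reducedUtility (productDist τ)) :
    ∃ σ : ∀ i, S i → ℝ, IsMixedProfile σ ∧ (∀ i, σ i ∈ stationary (α i)) ∧
      IsCorrelatedEquilibrium U (productDist σ) := by
  refine ⟨fun i => ∑ u, τ i u • u.dist (h.nonneg i), fun i => ?_, fun i => ?_, ?_⟩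
  · exact (convex_stdSimplex ℝ _).sum_mem (fun u _ => (hτ i).1 u) (hτ i).2
      fun u _ => u.dist_mem_stdSimplex _
  · exact Submodule.sum_smul_mem _ _ fun u _ => u.dist_mem_stationary _
  · rw [← liftDist_productDist]
    exact h.isCorrelatedEquilibrium_liftDist hce

end IsDualVector

theorem exists_isCorrelatedEquilibrium_productDist [∀ i, Nonempty (S i)]
    (huniq : {μ | IsCorrelatedEquilibrium U μ}.Subsingleton) :
    ∃ σ : ∀ i, S i → ℝ, IsMixedProfile σ ∧ IsCorrelatedEquilibrium U (productDist σ) := by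
  induction hn : ∑ i, Fintype.card (S i) using Nat.strong_induction_on generalizing S with
  | _ n ih =>
  cases subsingleton_or_nontrivial (∀ i, S i) with
  | inl _ =>
    have hpure : IsMixedProfile fun i => (Pi.single (Classical.arbitrary (S i)) 1 : S i → ℝ) :=
      fun i => single_mem_stdSimplex ℝ _
    exact ⟨_, hpure, isCorrelatedEquilibrium_productDist_of_subsingleton hpure⟩
  | inr _ =>
    obtain ⟨α, β, h, i, a, b, hab, hne⟩ := exists_isDualVector_ne_zero U huniq
    have hlt : ∑ j, Fintype.card (RecurrentClass (α j)) < n :=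
      hn ▸ Finset.sum_lt_sum (fun j _ => RecurrentClass.card_le (α j))
        ⟨i, Finset.mem_univ i, RecurrentClass.card_lt hab hne⟩
    obtain ⟨τ, hτ, hτce⟩ := ih _ hlt h.reducedUtility
      (h.subsingleton_isCorrelatedEquilibrium_reducedUtility huniq) rfl
    obtain ⟨σ, hσ, -, hce⟩ :=
      h.exists_stationary_of_isCorrelatedEquilibrium_reducedUtility hτ hτce
    exact ⟨σ, hσ, hce⟩

end FiniteGame

open FiniteGame in
theorem mainTheorem2 {ι : Type*} [Fintype ι] [DecidableEq ι]
    {S : ι → Type*} [∀ i, Fintype (S i)] [∀ i, DecidableEq (S i)]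
    (U : ι → (∀ i, S i) → ℝ) (μ : (∀ i, S i) → ℝ)
    (hμ : FiniteGame.IsCorrelatedEquilibrium U μ)
    (huniq : ∀ ν : (∀ i, S i) → ℝ, FiniteGame.IsCorrelatedEquilibrium U ν → ν = μ) :
    ∃ σ : ∀ i, S i → ℝ, μ = FiniteGame.productDist σ ∧ FiniteGame.IsQuasiStrictNash U σ := by
  have huniq' : {ν | IsCorrelatedEquilibrium U ν}.Subsingleton :=
    fun ν hν ν' hν' => (huniq ν hν).trans (huniq ν' hν').symm
  obtain ⟨s₀, -, -⟩ := Finset.exists_ne_zero_of_sum_ne_zero (hμ.1.2.trans_ne one_ne_zero)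
  have : ∀ i, Nonempty (S i) := fun i => ⟨s₀ i⟩
  obtain ⟨α, β, h, hβ, -⟩ := exists_isDualVector_strictly_complementary U
  obtain ⟨τ, hτ, hτce⟩ := exists_isCorrelatedEquilibrium_productDist h.reducedUtility
    (h.subsingleton_isCorrelatedEquilibrium_reducedUtility huniq')
  obtain ⟨σ, hσ, hstat, hce⟩ :=
    h.exists_stationary_of_isCorrelatedEquilibrium_reducedUtility hτ hτce
  obtain rfl := huniq _ hce
  refine ⟨σ, rfl, isNashEquilibrium_of_isCorrelatedEquilibrium_productDist hσ hce,
    fun i a ha => ?_⟩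
  obtain ⟨s, rfl, hs⟩ := h.exists_slack_eq_zero hσ (fun j _ => hstat j) ha
  obtain ⟨ν, hν, hpos⟩ := (hβ s).resolve_left hs.not_gt
  rw [huniq ν hν] at hpos
  exact ((hσ i).1 (s i)).lt_of_ne' fun hzero =>
    hpos.ne' (Finset.prod_eq_zero (Finset.mem_univ i) hzero)
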